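/- Heyting algebras are considered as algebras in the language $\{\wedge,\vee,\to,0,1\}$. A variety of Heyting algebras is the class of all Heyting algebras satisfying some set of equations $\forall\vec x\,(t(\vec x)=t'(\vec x))$ between terms; it is finitely axiomatisable if this set can be taken finite. An algebra is $k$-generated if it is generated by some subset with exactly $k$ elements. A variety is regularly $k$-finite if every $k$-generated algebra in it is finite and, up to isomorphism, it contains only finitely many $k$-generated algebras. Corollary. For every natural number $k\geq 0$ there is a finitely axiomatisable variety of Heyting algebras that is regularly $k$-finite and contains an infinite $(k+1)$-generated Heyting algebra. -/

import Mathlib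

universe u

namespace HeytingVariety

/-- The operation symbols `∧`, `∨`, `→`, `0`, `1` of Heyting algebras, indexed by arity. -/
inductive Op : ℕ → Type
  | inf : Op 2
  | sup : Op 2
  | imp : Op 2
  | bot : Op 0
  | top : Op 0

/-- The first-order language of Heyting algebras; it has no relation symbols. -/
def lang : FirstOrder.Language.{0, 0} where
  Functions := Op
  Relations := fun _ => Empty

/-- Every Heyting algebra interprets the language in the standard way. -/
instance structureOfHeyting (A : Type u) [HeytingAlgebra A] : lang.Structure A where
  funMap := fun {_} f =>
    match f with
    | Op.inf => fun x => x 0 ⊓ x 1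
    | Op.sup => fun x => x 0 ⊔ x 1
    | Op.imp => fun x => x 0 ⇨ x 1
    | Op.bot => fun _ => ⊥
    | Op.top => fun _ => ⊤
  RelMap := fun {_} r => nomatch r

/-- An equation `t = t'` between terms in the variables `x₀, x₁, x₂, …`. -/
structure Equation where
  lhs : lang.Term ℕ
  rhs : lang.Term ℕ

/-- The universal closure of the equation holds in `A`. -/
def Equation.HoldsIn (e : Equation) (A : Type u) [HeytingAlgebra A] : Prop :=
  ∀ v : ℕ → A, e.lhs.realize v = e.rhs.realize v

/-- The class of all Heyting algebras satisfying every equation in `E`. -/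
def models (E : Set Equation) : Set HeytAlg.{u} :=
  {A | ∀ e ∈ E, e.HoldsIn A}

/-- A variety of Heyting algebras: a class of Heyting algebras axiomatised by equations. -/
def IsVariety (V : Set HeytAlg.{u}) : Prop :=
  ∃ E : Set Equation, V = models E

/-- A class of Heyting algebras axiomatised by finitely many equations. -/
def IsFinitelyAxiomatisable (V : Set HeytAlg.{u}) : Prop :=
  ∃ E : Set Equation, E.Finite ∧ V = models E

/-- `A` is `k`-generated: some `G ⊆ A` with `|G| = k` generates `A`. -/
def IsGenerated (k : ℕ) (A : Type u) [HeytingAlgebra A] : Prop :=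
  ∃ G : Finset A, G.card = k ∧ FirstOrder.Language.Substructure.closure lang (G : Set A) = ⊤

/-- Every `k`-generated algebra in `V` is finite. -/
def IsKFinite (k : ℕ) (V : Set HeytAlg.{u}) : Prop :=
  ∀ A ∈ V, IsGenerated k A → Finite A

/-- `V` is `k`-finite and has only finitely many `k`-generated members up to isomorphism. -/
def IsRegularlyKFinite (k : ℕ) (V : Set HeytAlg.{u}) : Prop :=
  IsKFinite k V ∧
    ∃ S : Set HeytAlg.{u}, S.Finite ∧
      ∀ A ∈ V, IsGenerated k A → ∃ B ∈ S, Nonempty (CategoryTheory.Iso A B)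

end HeytingVariety

/-! The variety is given by finitely many equations valid in the algebra of lower sets of a single
poset. By `exists_finite_axioms`, such equations force regular k-finiteness once the k-generated
subalgebras of that algebra all inject into one finite set. So the poset must give a uniform bound
for k generators and an infinite subalgebra for k + 1.

For k ≥ 1 the poset is `Point ι` with 2^k + 1 indices: a point lies above everything on lower levels
except, one level down, the diagonal points carrying one of its indices. Since k lower sets cannot
separate 2^k + 1 bottom points, and this failure propagates upwards (`HasBlur.succ`), every level
has two bisimilar diagonal points. Hence stretches of levels not cut by the generators collapse
(`bisimilar_of_constant`). A lower set passes from full to empty within two levels, so the number of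
bisimilarity classes is bounded (`exists_representatives`), and generated sets are unions of
classes. With k + 1 generators the bottom points can be told apart, and each level is then definable
from the one below (`Point.infinite_closure`).

For k = 0 a single generator has too few nonempty colours for two indices; the dual Rieger–Nishimura
ladder is used instead. -/

open FirstOrder

namespace HeytingVariety

/-! ### Finite axiomatisation from a uniform bound on generated subalgebras. -/

theorem finite_sigma_op : Finite (Σ n, Op n) := by
  refine Finite.of_injective (β := Fin 5) (fun s => match s with
    | ⟨_, Op.inf⟩ => 0
    | ⟨_, Op.sup⟩ => 1
    | ⟨_, Op.imp⟩ => 2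
    | ⟨_, Op.bot⟩ => 3
    | ⟨_, Op.top⟩ => 4) ?_
  rintro ⟨_, _ | _⟩ ⟨_, _ | _⟩ h <;> simp_all

theorem finite_structure (Γ : Type*) [Finite Γ] : Finite (lang.Structure Γ) := by
  have := finite_sigma_op
  refine Finite.of_injective
    (β := (s : Σ n, Op n) → (Fin s.1 → Γ) → Γ) (fun S s => S.funMap (n := s.1) s.2) ?_
  intro S S' h
  refine Language.Structure.ext ?_ ?_
  · ext n f x
    exact congrFun (congrFun h ⟨n, f⟩) x
  · ext n r x
    exact r.elim

/-- A structure on `Γ` in which the terms distinguish at least as much as under `v`. -/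
theorem exists_structure_separating {k : ℕ} {A : Type u} [HeytingAlgebra A] {Γ : Type*}
    (v : Fin k → A) (e : A → Γ)
    (he : Set.InjOn e (Language.Substructure.closure lang (Set.range v) : Set A)) :
    ∃ (_ : lang.Structure Γ) (w : Fin k → Γ), ∀ t t' : lang.Term (Fin k),
      t.realize w = t'.realize w → t.realize v = t'.realize v := by
  classical
  set C := Language.Substructure.closure lang (Set.range v)
  have hC : ∀ t : lang.Term (Fin k), t.realize v ∈ C := fun t =>
    t.realize_mem _ fun i => Language.Substructure.subset_closure (Set.mem_range_self i)
  set g : Γ → A := Function.invFunOn e C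
  have hg : ∀ a ∈ C, g (e a) = a := fun a ha => he.leftInvOn_invFunOn ha
  -- The operations of `A` are transported along `e`. The result need not be a Heyting algebra, and
  -- its values away from the image of `C` are irrelevant.
  let S : lang.Structure Γ :=
    { funMap := fun f x => e (Language.Structure.funMap f (g ∘ x))
      RelMap := fun {_} r => nomatch r }
  have key : ∀ t : lang.Term (Fin k), t.realize (e ∘ v) = e (t.realize v) := by
    intro t
    induction t with
    | var i => rfl
    | func f ts ih =>
      change e (Language.Structure.funMap f (g ∘ fun i => (ts i).realize (e ∘ v))) = _
      simp only [Language.Term.realize_func]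
      congr 2
      funext i
      simp only [Function.comp_apply, ih i]
      exact hg _ (hC _)
  refine ⟨S, e ∘ v, fun t t' h => he (hC t) (hC t') ?_⟩
  rw [← key, ← key, h]

theorem isGenerated_iff_exists_fun {k : ℕ} {B : Type u} [HeytingAlgebra B]
    (h : IsGenerated k B) :
    ∃ v : Fin k → B, Language.Substructure.closure lang (Set.range v) = ⊤ := by
  obtain ⟨G, hG, hcl⟩ := h
  subst hG
  refine ⟨fun i => (G.equivFin.symm i : B), ?_⟩
  rw [← hcl]
  congr 1
  ext b
  constructor
  · rintro ⟨i, rfl⟩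
    exact (G.equivFin.symm i).2
  · intro hb
    exact ⟨G.equivFin ⟨b, hb⟩, by simp⟩

/-- Up to isomorphism there are finitely many Heyting algebras of bounded cardinality. -/
theorem exists_finite_representatives (N : ℕ) :
    ∃ S : Set HeytAlg.{u}, S.Finite ∧ ∀ A : HeytAlg.{u}, Finite A → Nat.card A ≤ N →
      ∃ B ∈ S, Nonempty (CategoryTheory.Iso A B) := by
  classical
  -- The order determines the Heyting operations, so relations on the sets `Fin n` with n ≤ N
  -- suffice as codes; codes of no algebra get a dummy value in `F`.
  let J := Σ n : Fin (N + 1), (Fin n → Fin n → Prop)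
  let Q : J → HeytAlg.{u} → Prop := fun j B =>
    ∃ e : B ≃ Fin j.1, ∀ a b : B, a ≤ b ↔ j.2 (e a) (e b)
  let F : J → HeytAlg.{u} := fun j => if h : ∃ B, Q j B then h.choose else HeytAlg.of PUnit
  refine ⟨Set.range F, Set.finite_range F, fun A hA hN => ?_⟩
  let e := Finite.equivFin A
  let j : J := ⟨⟨Nat.card A, by omega⟩, fun a b => e.symm a ≤ e.symm b⟩
  have hj : ∃ B, Q j B := ⟨A, e, fun a b => by simp [j]⟩
  refine ⟨F j, ⟨j, rfl⟩, ?_⟩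
  have hF : Q j (F j) := by
    simp only [F, dif_pos hj]
    exact hj.choose_spec
  obtain ⟨e', he'⟩ := hF
  let o : A ≃o F j :=
    { toEquiv := e.trans e'.symm
      map_rel_iff' := by
        intro a b
        rw [he']
        simp [j] }
  exact ⟨HeytAlg.Iso.mk o⟩

/-- Terms that agree under all assignments in all structures on `Γ` agree in `A`. There are finitely
many such behaviours `D`; `g` picks a term for each one that occurs. The axioms say that a variable,
or an operation applied to chosen terms, equals the chosen term of the same behaviour. In any model
the values of the chosen terms then form a subalgebra containing the generators, of size at most
that of `D`. -/
theorem exists_finite_axioms {k : ℕ} {A : Type u} [HeytingAlgebra A] {Γ : Type*} [Finite Γ]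
    (h : ∀ v : Fin k → A, ∃ e : A → Γ,
      Set.InjOn e (Language.Substructure.closure lang (Set.range v) : Set A)) :
    ∃ E : Set Equation, E.Finite ∧ (∀ e ∈ E, e.HoldsIn A) ∧
      IsRegularlyKFinite k (models.{u} E) := by
  classical
  have := finite_sigma_op
  have := finite_structure Γ
  let T := lang.Term (Fin k)
  let D := (lang.Structure Γ × (Fin k → Γ)) → Γ
  let Φ : T → D := fun t d => @Language.Term.realize lang Γ d.1 (Fin k) d.2 t
  have hΦ : ∀ t t' : T, Φ t = Φ t' → ∀ v : Fin k → A, t.realize v = t'.realize v := by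
    intro t t' htt v
    obtain ⟨e, he⟩ := h v
    obtain ⟨S, w, hS⟩ := exists_structure_separating v e he
    exact hS t t' (congrFun htt (S, w))
  have : Nonempty T := ⟨Language.Term.func (L := lang) (Op.bot : lang.Functions 0) Fin.elim0⟩
  let g : D → T := Function.invFun Φ
  have hg : ∀ t, Φ (g (Φ t)) = Φ t := fun t => Function.invFun_eq ⟨t, rfl⟩
  let eqn : T → Equation := fun t =>
    ⟨t.relabel Fin.val, (g (Φ t)).relabel Fin.val⟩
  let tm : (Fin k ⊕ Σ s : (Σ n, Op n), (Fin s.1 → D)) → T := fun x =>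
    match x with
    | Sum.inl i => Language.Term.var i
    | Sum.inr s => Language.Term.func (L := lang) (l := s.1.1) s.1.2 fun i => g (s.2 i)
  have hsub : ∀ B ∈ models.{u} (Set.range (eqn ∘ tm)), ∀ v : Fin k → B,
      Language.Substructure.closure lang (Set.range v) = ⊤ →
      Function.Surjective fun d => (g d).realize v := by
    intro B hB v hv
    have hE : ∀ x, (tm x).realize v = (g (Φ (tm x))).realize v := by
      intro x
      -- The value ⊥ is a filler: only the first k variables occur in the equation.
      have := hB (eqn (tm x)) ⟨x, rfl⟩ (fun n => if hn : n < k then v ⟨n, hn⟩ else ⊥)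
      simp only [eqn, Language.Term.realize_relabel] at this
      have hc : ((fun n => if hn : n < k then v ⟨n, hn⟩ else ⊥) ∘ Fin.val : Fin k → B) = v := by
        funext i
        simp
      rwa [hc] at this
    let M : lang.Substructure B :=
      { carrier := Set.range fun d => (g d).realize v
        fun_mem := by
          intro n f x hx
          choose d hd using hx
          have := hE (Sum.inr ⟨⟨n, f⟩, d⟩)
          refine ⟨_, this.symm.trans ?_⟩
          simp only [tm, Language.Term.realize_func]
          congr 1
          funext i
          exact hd i }
    have hM : M = ⊤ := by
      rw [eq_top_iff, ← hv, Language.Substructure.closure_le]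
      rintro _ ⟨i, rfl⟩
      exact ⟨_, (hE (Sum.inl i)).symm⟩
    intro b
    have : b ∈ M := hM ▸ Language.Substructure.mem_top b
    exact this
  obtain ⟨S, hS, hS'⟩ := exists_finite_representatives.{u} (Nat.card D)
  refine ⟨Set.range (eqn ∘ tm), Set.finite_range _, ?_, ?_, S, hS, ?_⟩
  · rintro _ ⟨x, rfl⟩ v
    simp only [eqn, Function.comp_apply, Language.Term.realize_relabel]
    exact hΦ _ _ (hg _).symm _
  · intro B hB hgen
    obtain ⟨v, hv⟩ := isGenerated_iff_exists_fun hgen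
    exact Finite.of_surjective _ (hsub B hB v hv)
  · intro B hB hgen
    obtain ⟨v, hv⟩ := isGenerated_iff_exists_fun hgen
    have hs := hsub B hB v hv
    exact hS' B (Finite.of_surjective _ hs) (Nat.card_le_card_of_surjective _ hs)

/-- An infinite `n`-generated subalgebra gives an infinite `n`-generated member of the variety. -/
theorem exists_infinite_generated {n : ℕ} {A : Type u} [HeytingAlgebra A] {E : Set Equation}
    (hE : ∀ e ∈ E, e.HoldsIn A) (v : Fin n → A)
    (hv : (Language.Substructure.closure lang (Set.range v) : Set A).Infinite) :
    ∃ B ∈ models.{u} E, Infinite B ∧ IsGenerated n B := by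
  classical
  set C := Language.Substructure.closure lang (Set.range v)
  let B := {a : A // a ∈ C}
  have mem2 : ∀ (f : Op 2) (a b : B), Language.Structure.funMap (L := lang) f ![a.1, b.1] ∈ C :=
    fun f a b => C.fun_mem f _ (by intro i; fin_cases i; exacts [a.2, b.2])
  have mem0 : ∀ f : Op 0, Language.Structure.funMap (L := lang) f (![] : Fin 0 → A) ∈ C :=
    fun f => C.fun_mem f _ fun i => i.elim0
  let _ : Max B := ⟨fun a b => ⟨a.1 ⊔ b.1, mem2 Op.sup a b⟩⟩
  let _ : Min B := ⟨fun a b => ⟨a.1 ⊓ b.1, mem2 Op.inf a b⟩⟩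
  let _ : HImp B := ⟨fun a b => ⟨a.1 ⇨ b.1, mem2 Op.imp a b⟩⟩
  let _ : Bot B := ⟨⟨⊥, mem0 Op.bot⟩⟩
  let _ : Top B := ⟨⟨⊤, mem0 Op.top⟩⟩
  let _ : Compl B := ⟨fun a => ⟨a.1ᶜ, by
    rw [← himp_bot]; exact mem2 Op.imp a ⊥⟩⟩
  let hB : HeytingAlgebra B := Function.Injective.heytingAlgebra (Subtype.val : B → A)
    Subtype.val_injective Iff.rfl Iff.rfl (fun _ _ => rfl) (fun _ _ => rfl) rfl rfl (fun _ => rfl)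
    (fun _ _ => rfl)
  let ι : B →[lang] A :=
    { toFun := Subtype.val
      map_fun' := by
        intro n f x
        cases f <;> rfl
      map_rel' := by
        intro n r
        exact r.elim }
  have hinf : Infinite B := hv.to_subtype
  let w : Fin n → B := fun i => ⟨v i, Language.Substructure.subset_closure ⟨i, rfl⟩⟩
  have hw : Language.Substructure.closure lang (Set.range w) = ⊤ := by
    have hmap : (Language.Substructure.closure lang (Set.range w)).map ι = C := by
      rw [Language.Substructure.map_closure, ← Set.range_comp]
      rfl
    rw [eq_top_iff]
    rintro b -
    have : b.1 ∈ (Language.Substructure.closure lang (Set.range w)).map ι := by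
      rw [hmap]
      exact b.2
    obtain ⟨b', hb', he⟩ := this
    rwa [Subtype.val_injective he] at hb'
  refine ⟨HeytAlg.of B, ?_, hinf, ?_⟩
  · intro e he x
    apply Subtype.val_injective
    have := hE e he (fun i => (x i).1)
    have h1 := fun t : lang.Term ℕ => Language.HomClass.realize_term ι (t := t) (v := x)
    exact (h1 _).symm.trans (this.trans (h1 _))
  -- The generators in `w` may coincide, so they are padded to exactly n elements.
  · obtain ⟨G, hG, hcard⟩ := Infinite.exists_superset_card_eq (Finset.univ.image w) n
      (Finset.card_image_le.trans (by simp))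
    refine ⟨G, hcard, ?_⟩
    rw [eq_top_iff, ← hw]
    refine Language.Substructure.closure_mono ?_
    rintro _ ⟨i, rfl⟩
    exact hG (Finset.mem_image_of_mem _ (Finset.mem_univ _))

/-! ### Bisimulations and generated algebras of lower sets. -/

section Bisimulation

variable {P : Type u} [PartialOrder P] {κ : Type*}

theorem mem_himp_lowerSet {a b : LowerSet P} {x : P} :
    x ∈ a ⇨ b ↔ ∀ y ≤ x, y ∈ a → y ∈ b := by
  constructor
  · intro hx y hy hya
    have h : (a ⇨ b) ⊓ a ≤ b := himp_inf_le
    exact h ⟨(a ⇨ b).lower hy hx, hya⟩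
  · intro h
    have h1 : LowerSet.Iic x ≤ a ⇨ b := by
      rw [le_himp_iff]
      rintro y ⟨hy, hya⟩
      exact h y hy hya
    exact h1 (le_refl x)

/-- A bisimulation on `P` respecting the lower sets `v c`. -/
def IsBisimulation (v : κ → LowerSet P) (B : P → P → Prop) : Prop :=
  ∀ x y, B x y → (∀ c, x ∈ v c ↔ y ∈ v c) ∧
    (∀ x' ≤ x, ∃ y' ≤ y, B x' y') ∧ ∀ y' ≤ y, ∃ x' ≤ x, B x' y'

/-- The largest bisimulation. -/
def Bisimilar (v : κ → LowerSet P) (x y : P) : Prop :=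
  ∃ B, IsBisimulation v B ∧ B x y

variable {v : κ → LowerSet P}

theorem isBisimulation_bisimilar : IsBisimulation v (Bisimilar v) := by
  rintro x y ⟨B, hB, hxy⟩
  obtain ⟨h1, h2, h3⟩ := hB x y hxy
  refine ⟨h1, fun x' hx' => ?_, fun y' hy' => ?_⟩
  · obtain ⟨y', hy', h⟩ := h2 x' hx'
    exact ⟨y', hy', B, hB, h⟩
  · obtain ⟨x', hx', h⟩ := h3 y' hy'
    exact ⟨x', hx', B, hB, h⟩

theorem Bisimilar.refl (x : P) : Bisimilar v x x :=
  ⟨Eq, by rintro x _ rfl; exact ⟨fun _ => Iff.rfl, fun x' h => ⟨x', h, rfl⟩, fun x' h => ⟨x', h, rfl⟩⟩,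
    rfl⟩

theorem Bisimilar.symm {x y : P} (h : Bisimilar v x y) : Bisimilar v y x := by
  refine ⟨fun a b => Bisimilar v b a, fun a b hab => ?_, h⟩
  obtain ⟨h1, h2, h3⟩ := isBisimulation_bisimilar b a hab
  exact ⟨fun c => (h1 c).symm, h3, h2⟩

theorem Bisimilar.trans {x y z : P} (h : Bisimilar v x y) (h' : Bisimilar v y z) :
    Bisimilar v x z := by
  refine ⟨fun a c => ∃ b, Bisimilar v a b ∧ Bisimilar v b c, ?_, y, h, h'⟩
  rintro a c ⟨b, hab, hbc⟩
  obtain ⟨h1, h2, h3⟩ := isBisimulation_bisimilar a b hab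
  obtain ⟨k1, k2, k3⟩ := isBisimulation_bisimilar b c hbc
  refine ⟨fun c => (h1 c).trans (k1 c), fun a' ha' => ?_, fun c' hc' => ?_⟩
  · obtain ⟨b', hb', hab'⟩ := h2 a' ha'
    obtain ⟨c', hc', hbc'⟩ := k2 b' hb'
    exact ⟨c', hc', b', hab', hbc'⟩
  · obtain ⟨b', hb', hbc'⟩ := k3 c' hc'
    obtain ⟨a', ha', hab'⟩ := h3 b' hb'
    exact ⟨a', ha', b', hab', hbc'⟩

/-- Adding the pair (x, y) to bisimilarity leaves a bisimulation. The matching points may equal y or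
x themselves, which allows points of different levels to be identified. -/
theorem bisimilar_of_views {x y : P} (hc : ∀ c, x ∈ v c ↔ y ∈ v c)
    (hx : ∀ x' < x, ∃ y' ≤ y, Bisimilar v x' y') (hy : ∀ y' < y, ∃ x' ≤ x, Bisimilar v x' y') :
    Bisimilar v x y := by
  refine ⟨fun a b => Bisimilar v a b ∨ (a = x ∧ b = y), ?_, Or.inr ⟨rfl, rfl⟩⟩
  rintro a b (hab | ⟨rfl, rfl⟩)
  · obtain ⟨h1, h2, h3⟩ := isBisimulation_bisimilar a b hab
    refine ⟨h1, fun a' ha' => ?_, fun b' hb' => ?_⟩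
    · obtain ⟨b', hb', h⟩ := h2 a' ha'
      exact ⟨b', hb', Or.inl h⟩
    · obtain ⟨a', ha', h⟩ := h3 b' hb'
      exact ⟨a', ha', Or.inl h⟩
  · refine ⟨hc, fun a' ha' => ?_, fun b' hb' => ?_⟩
    · rcases ha'.eq_or_lt with rfl | ha'
      · exact ⟨b, le_rfl, Or.inr ⟨rfl, rfl⟩⟩
      · obtain ⟨b', hb', h⟩ := hx a' ha'
        exact ⟨b', hb', Or.inl h⟩
    · rcases hb'.eq_or_lt with rfl | hb'
      · exact ⟨a, le_rfl, Or.inr ⟨rfl, rfl⟩⟩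
      · obtain ⟨a', ha', h⟩ := hy b' hb'
        exact ⟨a', ha', Or.inl h⟩

/-- The sets invariant under bisimilarity form a subalgebra; the back condition handles implication.
-/
theorem Bisimilar.mem_iff {x y : P} (hxy : Bisimilar v x y) {U : LowerSet P}
    (hU : U ∈ Language.Substructure.closure lang (Set.range v)) : x ∈ U ↔ y ∈ U := by
  let M : lang.Substructure (LowerSet P) :=
    { carrier := {U | ∀ x y, Bisimilar v x y → x ∈ U → y ∈ U}
      fun_mem := by
        intro n f U hU x y hxy hx
        cases f with
        | inf => exact ⟨hU 0 x y hxy hx.1, hU 1 x y hxy hx.2⟩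
        | sup => exact hx.imp (hU 0 x y hxy) (hU 1 x y hxy)
        | imp =>
          change y ∈ U 0 ⇨ U 1
          have hx : x ∈ U 0 ⇨ U 1 := hx
          rw [mem_himp_lowerSet] at hx ⊢
          intro y' hy' h0
          obtain ⟨x', hx', h⟩ := (isBisimulation_bisimilar x y hxy).2.2 y' hy'
          exact hU 1 _ _ h (hx x' hx' (hU 0 _ _ h.symm h0))
        | bot => exact hx
        | top => exact hx }
  have hM : Language.Substructure.closure lang (Set.range v) ≤ M := by
    rw [Language.Substructure.closure_le]
    rintro _ ⟨c, rfl⟩ x y hxy hx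
    exact ((isBisimulation_bisimilar x y hxy).1 c).1 hx
  exact ⟨hM hU x y hxy, hM hU y x hxy.symm⟩

theorem injOn_closure_of_representatives {I : Type*} (ρ : I → P)
    (hρ : ∀ x, ∃ i, Bisimilar v x (ρ i)) :
    Set.InjOn (fun (U : LowerSet P) i => ρ i ∈ U)
      (Language.Substructure.closure lang (Set.range v) : Set (LowerSet P)) := by
  intro U hU W hW h
  ext x
  obtain ⟨i, hi⟩ := hρ x
  have := congrFun h i
  exact (hi.mem_iff hU).trans ((Iff.of_eq this).trans (hi.mem_iff hW).symm)

end Bisimulation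

/-! ### Closure of subalgebras under the operations. -/

section Operations

variable {A : Type u} [HeytingAlgebra A] (C : lang.Substructure A)

theorem sup_mem_substructure {a b : A} (ha : a ∈ C) (hb : b ∈ C) : a ⊔ b ∈ C :=
  C.fun_mem (n := 2) Op.sup ![a, b] (by intro i; fin_cases i; exacts [ha, hb])

theorem inf_mem_substructure {a b : A} (ha : a ∈ C) (hb : b ∈ C) : a ⊓ b ∈ C :=
  C.fun_mem (n := 2) Op.inf ![a, b] (by intro i; fin_cases i; exacts [ha, hb])

theorem himp_mem_substructure {a b : A} (ha : a ∈ C) (hb : b ∈ C) : a ⇨ b ∈ C :=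
  C.fun_mem (n := 2) Op.imp ![a, b] (by intro i; fin_cases i; exacts [ha, hb])

theorem bot_mem_substructure : (⊥ : A) ∈ C :=
  C.fun_mem (n := 0) Op.bot ![] fun i => i.elim0

theorem top_mem_substructure : (⊤ : A) ∈ C :=
  C.fun_mem (n := 0) Op.top ![] fun i => i.elim0

theorem finset_sup_mem_substructure {β : Type*} (s : Finset β) {f : β → A}
    (hf : ∀ i ∈ s, f i ∈ C) : s.sup f ∈ C :=
  Finset.sup_induction (bot_mem_substructure C)
    (fun _ ha _ hb => sup_mem_substructure C ha hb) hf

theorem finset_inf_mem_substructure {β : Type*} (s : Finset β) {f : β → A}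
    (hf : ∀ i ∈ s, f i ∈ C) : s.inf f ∈ C :=
  Finset.inf_induction (top_mem_substructure C)
    (fun _ ha _ hb => inf_mem_substructure C ha hb) hf

end Operations

/-! ### Level orders, and the ladder for k = 0. -/

/-- The order in which `q` lies above all points at least two levels down, and above the points
one level down that it does not miss. -/
@[reducible]
def levelOrder {α : Type u} (lev : α → ℕ) (miss : α → α → Prop) : PartialOrder α where
  le p q := p = q ∨ lev p + 2 ≤ lev q ∨ (lev p + 1 = lev q ∧ ¬ miss q p)
  le_refl p := Or.inl rfl
  le_trans := by
    rintro p q r (rfl | h) (rfl | h')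
    · exact Or.inl rfl
    · exact Or.inr h'
    · exact Or.inr h
    · refine Or.inr (Or.inl ?_)
      rcases h with h | h <;> rcases h' with h' | h' <;> omega
  le_antisymm := by
    rintro p q (rfl | h) (h' | h')
    · rfl
    · rfl
    · exact h'.symm
    · rcases h with h | h <;> rcases h' with h' | h' <;> omega

/-- The natural numbers ordered as the dual of the Rieger–Nishimura ladder. -/
structure Ladder : Type u where
  val : ℕ

instance : PartialOrder Ladder.{u} := levelOrder Ladder.val fun _ _ => True

theorem Ladder.le_iff {p q : Ladder.{u}} : p ≤ q ↔ p = q ∨ p.val + 2 ≤ q.val := by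
  change (_ ∨ _ ∨ (_ ∧ ¬ True)) ↔ _
  simp

/-- The points of the ladder below `n`. -/
def Ladder.initial (n : ℕ) : LowerSet Ladder.{u} where
  carrier := {p | p.val < n}
  lower' := by
    intro p q h hp
    rcases Ladder.le_iff.1 h with rfl | h
    · exact hp
    · change _ < n
      have : p.val < n := hp
      omega

/-- The implication consists of the points not above n, and these are n + 1 and the points smaller
than n. -/
theorem Ladder.initial_succ (n : ℕ) :
    initial.{u} (n + 2) = (initial (n + 1) ⇨ initial n) ⊔ initial (n + 1) := by
  ext p
  change p.val < n + 2 ↔ p ∈ initial (n + 1) ⇨ initial n ∨ p.val < n + 1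
  rw [mem_himp_lowerSet]
  change _ ↔ (∀ q ≤ p, q.val < n + 1 → q.val < n) ∨ _
  constructor
  · intro hp
    by_cases h : p.val < n + 1
    · exact Or.inr h
    · left
      intro q hq hqn
      rcases Ladder.le_iff.1 hq with rfl | hq <;> omega
  · rintro (h | h)
    · by_contra hp
      have := h ⟨n⟩ (Ladder.le_iff.2 (Or.inr (by change n + 2 ≤ _; omega))) (by simp)
      simp at this
    · omega

theorem Ladder.infinite_closure :
    (Language.Substructure.closure lang
      (Set.range fun _ : Fin 1 => initial.{u} 1) : Set (LowerSet Ladder.{u})).Infinite := by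
  set C := Language.Substructure.closure lang (Set.range fun _ : Fin 1 => initial.{u} 1)
  have hmem : ∀ n, initial.{u} n ∈ C ∧ initial.{u} (n + 1) ∈ C := by
    intro n
    induction n with
    | zero =>
      refine ⟨?_, Language.Substructure.subset_closure ⟨0, rfl⟩⟩
      have : initial.{u} 0 = ⊥ := by
        ext p
        change p.val < 0 ↔ False
        simp
      rw [this]
      exact bot_mem_substructure C
    | succ n ih =>
      refine ⟨ih.2, ?_⟩
      rw [Ladder.initial_succ]
      exact sup_mem_substructure C (himp_mem_substructure C ih.2 ih.1) ih.2
  refine Set.infinite_of_injective_forall_mem (f := initial.{u}) (fun a b h => ?_)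
    fun n => (hmem n).1
  by_contra hab
  rcases Nat.lt_or_gt_of_ne hab with hab | hab
  · have : (⟨a⟩ : Ladder) ∈ initial a := by rw [h]; exact hab
    exact lt_irrefl a this
  · have : (⟨b⟩ : Ladder) ∈ initial b := by rw [← h]; exact hab
    exact lt_irrefl b this

theorem injOn_closure_empty {A : Type u} [HeytingAlgebra A] (v : Fin 0 → A) :
    Set.InjOn (fun a => a = ⊤)
      (Language.Substructure.closure lang (Set.range v) : Set A) := by
  let M : lang.Substructure A :=
    { carrier := {⊥, ⊤}
      fun_mem := by
        intro n f x hx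
        cases f with
        | inf =>
          change x 0 ⊓ x 1 ∈ _
          rcases hx 0 with h0 | h0 <;> rcases hx 1 with h1 | h1 <;> simp_all
        | sup =>
          change x 0 ⊔ x 1 ∈ _
          rcases hx 0 with h0 | h0 <;> rcases hx 1 with h1 | h1 <;> simp_all
        | imp =>
          change x 0 ⇨ x 1 ∈ _
          rcases hx 0 with h0 | h0 <;> rcases hx 1 with h1 | h1 <;> simp_all
        | bot => exact Or.inl rfl
        | top => exact Or.inr rfl }
  have hM : Language.Substructure.closure lang (Set.range v) ≤ M := by
    rw [Language.Substructure.closure_le]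
    rintro _ ⟨i, rfl⟩
    exact i.elim0
  intro a ha b hb hab
  have hab : a = ⊤ ↔ b = ⊤ := Iff.of_eq hab
  rcases hM ha with h | h <;> rcases hM hb with h' | h'
  · exact h.trans h'.symm
  · exact (hab.2 h').trans h'.symm
  · exact h.trans (hab.1 h).symm
  · exact h.trans h'.symm

/-! ### The poset for k ≥ 1. -/

/-- The points of a poset of infinite depth: every level has a point for each pair of indices,
except that the bottom level has only the diagonal pairs. -/
@[ext]
structure Point (ι : Type u) : Type u where
  lev : ℕ
  fst : ι
  snd : ι
  diag : lev = 0 → fst = snd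

namespace Point

variable {ι : Type u}

/-- The diagonal point with index `i` on level `l`. -/
def principal (l : ℕ) (i : ι) : Point ι := ⟨l, i, i, fun _ => rfl⟩

/-- The point with indices `i`, `j` on a level other than the bottom one. -/
def pair (l : ℕ) (i j : ι) : Point ι := ⟨l + 1, i, j, fun h => absurd h (Nat.succ_ne_zero l)⟩

/-- Off-diagonal points are missed by nothing on higher levels; a diagonal point is missed exactly
by the points one level up that carry its index. -/
instance : PartialOrder (Point ι) :=
  levelOrder lev fun q p => p.fst = p.snd ∧ (p.fst = q.fst ∨ p.fst = q.snd)

theorem le_iff {p q : Point ι} : p ≤ q ↔ p = q ∨ lev p + 2 ≤ lev q ∨ (lev p + 1 = lev q ∧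
    ¬ (p.fst = p.snd ∧ (p.fst = q.fst ∨ p.fst = q.snd))) := Iff.rfl

theorem lt_iff {p q : Point ι} : p < q ↔ lev p + 2 ≤ lev q ∨ (lev p + 1 = lev q ∧
    ¬ (p.fst = p.snd ∧ (p.fst = q.fst ∨ p.fst = q.snd))) := by
  rw [lt_iff_le_and_ne, le_iff]
  constructor
  · rintro ⟨rfl | h, hne⟩
    · exact absurd rfl hne
    · exact h
  · intro h
    refine ⟨Or.inr h, ?_⟩
    rintro rfl
    rcases h with h | h <;> omega

theorem lev_lt_of_lt {p q : Point ι} (h : p < q) : p.lev < q.lev := by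
  rcases lt_iff.1 h with h | h <;> omega

theorem lt_of_lev {p q : Point ι} (h : p.lev + 2 ≤ q.lev) : p < q := lt_iff.2 (Or.inl h)

theorem lt_of_offDiag {p q : Point ι} (h : p.lev < q.lev) (hp : p.fst ≠ p.snd) : p < q := by
  rw [lt_iff]
  by_cases h2 : p.lev + 2 ≤ q.lev
  · exact Or.inl h2
  · exact Or.inr ⟨by omega, fun h => hp h.1⟩

theorem lt_of_fst_ne {p q : Point ι} (h : p.lev < q.lev) (h1 : p.fst ≠ q.fst)
    (h2 : p.fst ≠ q.snd) : p < q := by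
  rw [lt_iff]
  by_cases h3 : p.lev + 2 ≤ q.lev
  · exact Or.inl h3
  · exact Or.inr ⟨by omega, fun h => h.2.elim h1 h2⟩

theorem principal_lt_principal_succ {l : ℕ} {i j : ι} (h : i ≠ j) :
    principal l i < principal (l + 1) j :=
  lt_of_fst_ne (Nat.lt_succ_self l) h h

theorem eq_principal {p : Point ι} (h : p.fst = p.snd) : p = principal p.lev p.fst := by
  ext
  · rfl
  · rfl
  · exact h.symm

variable {k : ℕ} (v : Fin k → LowerSet (Point ι))

/-- More principal points on level `l` have the same view than can be told apart by the members of
`v` that are not yet exhausted there. -/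
def HasBlur (l : ℕ) : Prop :=
  ∃ (Y : Finset ι) (D : Finset (Fin k)), 2 ^ (k - D.card) < Y.card ∧
    (∀ c ∈ D, ∀ y ∈ Y, principal l y ∉ v c) ∧
    ∀ y ∈ Y, ∀ y' ∈ Y, ∀ z < principal l y, ∃ z' < principal l y', Bisimilar v z z'

end Point

/-! ### Every level has two bisimilar principal points. -/

/-- The elements without a twin inject into the image of `f` and avoid the value of some collision,
whence the strict inequality. -/
theorem card_lt_card_filter_add {α β : Type*} [DecidableEq α] [DecidableEq β] (Y : Finset α)
    (f : α → β) {n : ℕ} (hn : (Y.image f).card ≤ n) (hY : n < Y.card) :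
    Y.card < (Y.filter fun y => ∃ y' ∈ Y, y' ≠ y ∧ f y' = f y).card + n := by
  set Z := Y.filter fun y => ∃ y' ∈ Y, y' ≠ y ∧ f y' = f y with hZ
  obtain ⟨a, ha, b, hb, hab, hf⟩ :=
    Finset.exists_ne_map_eq_of_card_lt_of_maps_to (lt_of_le_of_lt hn hY)
      (fun x hx => Finset.mem_image_of_mem f hx)
  have hinj : Set.InjOn f (Y \ Z : Finset α) := by
    intro x hx y hy hxy
    by_contra hne
    rw [Finset.mem_coe, Finset.mem_sdiff] at hx hy
    exact hy.2 (Finset.mem_filter.2 ⟨hy.1, x, hx.1, hne, hxy⟩)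
  have h1 : ((Y \ Z).image f).card = (Y \ Z).card := Finset.card_image_of_injOn hinj
  have h2 : (Y \ Z).image f ⊂ Y.image f := by
    rw [Finset.ssubset_iff_of_subset (Finset.image_subset_image Finset.sdiff_subset)]
    refine ⟨f a, Finset.mem_image_of_mem f ha, fun h => ?_⟩
    obtain ⟨x, hx, hxa⟩ := Finset.mem_image.1 h
    rw [Finset.mem_sdiff] at hx
    refine hx.2 (Finset.mem_filter.2 ⟨hx.1, ?_⟩)
    by_cases h : a = x
    · exact ⟨b, hb, fun h' => hab (h.trans h'.symm), by rw [← h, hf]⟩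
    · exact ⟨a, ha, h, hxa.symm⟩
  have h3 := Finset.card_lt_card h2
  have h4 : (Y \ Z).card + Z.card = Y.card :=
    Finset.card_sdiff_add_card_eq_card (Finset.filter_subset _ _)
  omega

/-- With e = a - d, y' is at least 2^d (2^e - 1) + 2, which exceeds 2^e. When d = a this needs the
strictness of `hy'`. -/
theorem two_pow_lt_of_blur {a d y y' : ℕ} (hd : d ≤ a) (hy : 2 ^ a < y) (hy' : y < y' + 2 ^ d) :
    2 ^ (a - d) < y' := by
  obtain ⟨e, rfl⟩ := Nat.exists_eq_add_of_le hd
  rw [Nat.add_sub_cancel_left]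
  rw [pow_add] at hy
  have h1 : 1 ≤ 2 ^ d := Nat.one_le_two_pow
  have h2 : 1 ≤ 2 ^ e := Nat.one_le_two_pow
  nlinarith

namespace Point

variable {ι : Type u} {k : ℕ} {v : Fin k → LowerSet (Point ι)}

theorem bisimilar_of_lt {x y : Point ι} (hc : ∀ c, x ∈ v c ↔ y ∈ v c)
    (hx : ∀ z < x, ∃ z' < y, Bisimilar v z z') (hy : ∀ z < y, ∃ z' < x, Bisimilar v z z') :
    Bisimilar v x y := by
  refine bisimilar_of_views hc (fun z hz => ?_) fun z hz => ?_
  · obtain ⟨z', hz', h⟩ := hx z hz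
    exact ⟨z', hz'.le, h⟩
  · obtain ⟨z', hz', h⟩ := hy z hz
    exact ⟨z', hz'.le, h.symm⟩

theorem hasBlur_zero [Fintype ι] (hι : 2 ^ k < Fintype.card ι) : HasBlur v 0 := by
  refine ⟨Finset.univ, ∅, by simpa using hι, by simp, fun y _ y' _ z hz => ?_⟩
  exact absurd (lev_lt_of_lt hz) (Nat.not_lt_zero _)

/-- Let `D'` collect the generators missing some principal point of `Y`. Points of `Y` with the same
colour over `D' \ D` are bisimilar; keep the indices that have such a twin. One level up, a kept
point misses only its own index, whose twin it sees, so the views still agree. It is also outside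
every set in `D'`: it lies above a missing point, or above the twin of one. Separating by d new
generators thus uses up d of the k available. -/
theorem HasBlur.succ {l : ℕ} (h : HasBlur v l) : HasBlur v (l + 1) := by
  classical
  obtain ⟨Y, D, hcard, hD, hview⟩ := h
  let D' : Finset (Fin k) := Finset.univ.filter fun c => ∃ y ∈ Y, principal l y ∉ v c
  have hYne : Y.Nonempty := Finset.card_pos.1 (lt_of_le_of_lt (Nat.zero_le _) hcard)
  have hDD' : D ⊆ D' := by
    intro c hc
    obtain ⟨y, hy⟩ := hYne
    exact Finset.mem_filter.2 ⟨Finset.mem_univ _, y, hy, hD c hc y hy⟩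
  let col : ι → Finset (Fin k) := fun y => (D' \ D).filter fun c => principal l y ∈ v c
  have hcol : ∀ y ∈ Y, ∀ y' ∈ Y, col y = col y' →
      ∀ c, principal l y ∈ v c ↔ principal l y' ∈ v c := by
    intro y hy y' hy' h c
    by_cases hc : c ∈ D
    · exact iff_of_false (hD c hc y hy) (hD c hc y' hy')
    by_cases hc' : c ∈ D'
    · have := Finset.ext_iff.1 h c
      simpa [col, hc, hc'] using this
    · have : ∀ x ∈ Y, principal l x ∈ v c := by
        intro x hx
        by_contra hxc
        exact hc' (Finset.mem_filter.2 ⟨Finset.mem_univ _, x, hx, hxc⟩)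
      exact iff_of_true (this y hy) (this y' hy')
  have hsim : ∀ y ∈ Y, ∀ y' ∈ Y, col y = col y' →
      Bisimilar v (principal l y) (principal l y') := fun y hy y' hy' h =>
    bisimilar_of_lt (hcol y hy y' hy' h) (hview y hy y' hy') (hview y' hy' y hy)
  set d := (D' \ D).card with hd
  have hd1 : d + D.card = D'.card := Finset.card_sdiff_add_card_eq_card hDD'
  have hd2 : D'.card ≤ k := (Finset.card_le_univ D').trans (by simp)
  have himg : (Y.image col).card ≤ 2 ^ d := by
    rw [hd, ← Finset.card_powerset]
    refine Finset.card_le_card fun s hs => ?_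
    obtain ⟨y, -, rfl⟩ := Finset.mem_image.1 hs
    exact Finset.mem_powerset.2 (Finset.filter_subset _ _)
  have hlt : 2 ^ d < Y.card :=
    lt_of_le_of_lt (Nat.pow_le_pow_right (by norm_num) (by omega)) hcard
  have hcount := card_lt_card_filter_add Y col himg hlt
  refine ⟨Y.filter fun y => ∃ y' ∈ Y, y' ≠ y ∧ col y' = col y, D', ?_, ?_, ?_⟩
  · have := two_pow_lt_of_blur (a := k - D.card) (by omega) hcard hcount
    rwa [show k - D'.card = k - D.card - d by omega]
  · intro c hc y hy hyc
    obtain ⟨hyY, y', hy'Y, hne, heq⟩ := Finset.mem_filter.1 hy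
    obtain ⟨x, hxY, hxc⟩ := (Finset.mem_filter.1 hc).2
    by_cases hxy : x = y
    · subst hxy
      have h1 := (v c).lower (principal_lt_principal_succ (l := l) hne).le hyc
      exact hxc ((hcol _ hy'Y _ hxY heq c).1 h1)
    · exact hxc ((v c).lower (principal_lt_principal_succ hxy).le hyc)
  · intro y hy y' hy' z hz
    by_cases hz' : z < principal (l + 1) y'
    · exact ⟨z, hz', Bisimilar.refl z⟩
    obtain ⟨hy'Y, x, hxY, hne, heq⟩ := Finset.mem_filter.1 hy'
    have hzl : z = principal l y' := by
      have h1 := lev_lt_of_lt hz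
      rw [lt_iff] at hz'
      push Not at hz'
      simp only [principal] at h1 hz' ⊢
      have h2 := hz'.2 (by omega)
      ext
      · change z.lev = l
        omega
      · exact h2.2.elim id id
      · exact h2.1.symm.trans (h2.2.elim id id)
    subst hzl
    exact ⟨principal l x, principal_lt_principal_succ hne, hsim _ hy'Y _ hxY heq.symm⟩

theorem hasBlur [Fintype ι] (hι : 2 ^ k < Fintype.card ι) (l : ℕ) : HasBlur v l := by
  induction l with
  | zero => exact hasBlur_zero hι
  | succ l ih => exact ih.succ

theorem HasBlur.exists_bisimilar {l : ℕ} (h : HasBlur v l) :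
    ∃ i j : ι, i ≠ j ∧ Bisimilar v (principal l i) (principal l j) := by
  classical
  obtain ⟨Y, D, hcard, hD, hview⟩ := h
  obtain ⟨i, hi, j, hj, hij, hf⟩ :=
    Finset.exists_ne_map_eq_of_card_lt_of_maps_to (s := Y) (t := (Finset.univ \ D).powerset)
      (f := fun y => (Finset.univ \ D).filter fun c => principal l y ∈ v c)
      (by rw [Finset.card_powerset, Finset.card_univ_sdiff, Fintype.card_fin]; exact hcard)
      (fun y _ => Finset.mem_coe.2 (Finset.mem_powerset.2 (Finset.filter_subset _ _)))
  refine ⟨i, j, hij, bisimilar_of_lt (fun c => ?_) (hview i hi j hj) (hview j hj i hi)⟩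
  by_cases hc : c ∈ D
  · exact iff_of_false (hD c hc i hi) (hD c hc j hj)
  · have := Finset.ext_iff.1 hf c
    simpa [hc] using this

end Point

/-! ### Collapse of uncut levels and the bound on bisimilarity classes. -/

namespace Point

variable {ι : Type u} {k : ℕ} {v : Fin k → LowerSet (Point ι)}

/-- Everything two or more levels down is seen anyway, so only the level directly below has to be
compared. -/
theorem bisimilar_of_level {n : ℕ} {x y : Point ι} (hx : x.lev = n + 1) (hy : y.lev = n + 1)
    (hc : ∀ c, x ∈ v c ↔ y ∈ v c)
    (h1 : ∀ z, z.lev = n → z < x → ∃ z' < y, Bisimilar v z z')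
    (h2 : ∀ z, z.lev = n → z < y → ∃ z' < x, Bisimilar v z z') : Bisimilar v x y := by
  have key : ∀ {x y : Point ι}, x.lev = n + 1 → y.lev = n + 1 →
      (∀ z, z.lev = n → z < x → ∃ z' < y, Bisimilar v z z') →
      ∀ z < x, ∃ z' < y, Bisimilar v z z' := by
    intro x y hx hy h z hz
    have := lev_lt_of_lt hz
    by_cases hzn : z.lev = n
    · exact h z hzn hz
    · exact ⟨z, lt_of_lev (by omega), Bisimilar.refl z⟩
  exact bisimilar_of_lt hc (key hx hy h1) (key hy hx h2)

theorem lt_pair_of_ne {l : ℕ} {a i j : ι} (hi : a ≠ i) (hj : a ≠ j) :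
    principal l a < pair l i j :=
  lt_of_fst_ne (Nat.lt_succ_self l) hi hj

theorem fst_ne_of_lt {p q : Point ι} (h : p < q) (hl : p.lev + 1 = q.lev) (hp : p.fst = p.snd) :
    p.fst ≠ q.fst ∧ p.fst ≠ q.snd := by
  rcases lt_iff.1 h with h | h
  · omega
  · have := h.2
    push Not at this
    exact this hp

theorem bisimilar_of_principal_bisimilar {l : ℕ} {j j' : ι} (hjj : j ≠ j')
    (h : Bisimilar v (principal l j) (principal l j'))
    (hc : ∀ p q : Point ι, p.lev = l + 1 → q.lev = l + 1 → ∀ c, p ∈ v c ↔ q ∈ v c) :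
    Bisimilar v (principal (l + 1) j) (principal (l + 1) j') := by
  have key : ∀ {j j' : ι}, j ≠ j' → Bisimilar v (principal l j) (principal l j') →
      ∀ z : Point ι, z.lev = l → z < principal (l + 1) j →
        ∃ z' < principal (l + 1) j', Bisimilar v z z' := by
    intro j j' hjj h z hz hlt
    by_cases hd : z.fst = z.snd
    · by_cases ha : z.fst = j'
      · refine ⟨principal l j, principal_lt_principal_succ hjj, ?_⟩
        rw [eq_principal hd, hz, ha]
        exact h.symm
      · exact ⟨z, lt_of_fst_ne (by rw [hz]; exact Nat.lt_succ_self l) ha ha, Bisimilar.refl z⟩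
    · exact ⟨z, lt_of_offDiag (by rw [hz]; exact Nat.lt_succ_self l) hd, Bisimilar.refl z⟩
  exact bisimilar_of_level rfl rfl (hc _ _ rfl rfl) (key hjj h) (key hjj.symm h.symm)

/-- The second index makes the pair miss the principal point j as well, but it still sees the
bisimilar point j'. -/
theorem bisimilar_pair_of_principal_bisimilar {l : ℕ} {i j j' : ι} (hjj : j ≠ j')
    (hij' : i ≠ j') (h : Bisimilar v (principal l j) (principal l j'))
    (hc : ∀ p q : Point ι, p.lev = l + 1 → q.lev = l + 1 → ∀ c, p ∈ v c ↔ q ∈ v c) :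
    Bisimilar v (principal (l + 1) i) (pair l i j) := by
  refine bisimilar_of_level rfl rfl (hc _ _ rfl rfl) (fun z hz hlt => ?_) fun z hz hlt => ?_
  · by_cases hd : z.fst = z.snd
    · by_cases ha : z.fst = j
      · refine ⟨principal l j', lt_pair_of_ne hij'.symm hjj.symm, ?_⟩
        rw [eq_principal hd, hz, ha]
        exact h
      · have hi := (fst_ne_of_lt hlt (by rw [hz]; rfl) hd).1
        exact ⟨z, lt_of_fst_ne (by rw [hz]; exact Nat.lt_succ_self l) hi ha, Bisimilar.refl z⟩
    · exact ⟨z, lt_of_offDiag (by rw [hz]; exact Nat.lt_succ_self l) hd, Bisimilar.refl z⟩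
  · by_cases hd : z.fst = z.snd
    · have hi := (fst_ne_of_lt hlt (by rw [hz]; rfl) hd).1
      exact ⟨z, lt_of_fst_ne (by rw [hz]; exact Nat.lt_succ_self l) hi hi, Bisimilar.refl z⟩
    · exact ⟨z, lt_of_offDiag (by rw [hz]; exact Nat.lt_succ_self l) hd, Bisimilar.refl z⟩

/-- Once two principal points are bisimilar, levels that `v` does not separate collapse. -/
theorem bisimilar_of_constant {l : ℕ} {j j' a : ι} (hjj : j ≠ j') (haj : a ≠ j) (haj' : a ≠ j')
    (h : Bisimilar v (principal l j) (principal l j'))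
    (hc : ∀ p q : Point ι, l < p.lev → p.lev ≤ l + 4 → l < q.lev → q.lev ≤ l + 4 →
      ∀ c, p ∈ v c ↔ q ∈ v c)
    {p q : Point ι} (hp : p.lev = l + 4) (hq : q.lev = l + 3) : Bisimilar v p q := by
  have hc1 : ∀ p q : Point ι, p.lev = l + 1 → q.lev = l + 1 → ∀ c, p ∈ v c ↔ q ∈ v c :=
    fun p q hp hq => hc p q (by omega) (by omega) (by omega) (by omega)
  -- Bad points miss both twins. They are off-diagonal, as j ≠ j', so every point one level up sees
  -- them.
  let Bad : Point ι → Prop := fun x => (j = x.fst ∨ j = x.snd) ∧ (j' = x.fst ∨ j' = x.snd)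
  have see1 : ∀ x : Point ι, x.lev = l + 2 → ¬ Bad x → ∀ z : Point ι, z.lev = l + 1 →
      ∃ z' < x, Bisimilar v z z' := by
    intro x hx hbad z hz
    by_cases hd : z.fst = z.snd
    · rw [eq_principal hd, hz]
      have hz2 : ∀ b, b ≠ x.fst → b ≠ x.snd → principal (l + 1) b < x := fun b =>
        lt_of_fst_ne (p := principal (l + 1) b) (by rw [hx]; exact Nat.lt_succ_self _)
      have hsim := bisimilar_of_principal_bisimilar hjj h hc1
      have hdich : (j ≠ x.fst ∧ j ≠ x.snd) ∨ (j' ≠ x.fst ∧ j' ≠ x.snd) := by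
        by_contra hcon
        push Not at hcon
        exact hbad ⟨by tauto, by tauto⟩
      by_cases h1 : z.fst = j
      · rw [h1]
        rcases hdich with hd | hd
        · exact ⟨_, hz2 _ hd.1 hd.2, Bisimilar.refl _⟩
        · exact ⟨_, hz2 _ hd.1 hd.2, hsim⟩
      by_cases h2 : z.fst = j'
      · rw [h2]
        rcases hdich with hd | hd
        · exact ⟨_, hz2 _ hd.1 hd.2, hsim.symm⟩
        · exact ⟨_, hz2 _ hd.1 hd.2, Bisimilar.refl _⟩
      -- The point `x` may miss `z`, but not this off-diagonal copy of `z`.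
      · exact ⟨pair l z.fst j, lt_of_offDiag (by rw [hx]; exact Nat.lt_succ_self _) h1,
          bisimilar_pair_of_principal_bisimilar hjj h2 h hc1⟩
    · exact ⟨z, lt_of_offDiag (by omega) hd, Bisimilar.refl z⟩
  have sim2 : ∀ x y : Point ι, x.lev = l + 2 → y.lev = l + 2 → ¬ Bad x → ¬ Bad y →
      Bisimilar v x y := fun x y hx hy hbx hby =>
    bisimilar_of_level hx hy (hc x y (by omega) (by omega) (by omega) (by omega))
      (fun z hz _ => see1 y hy hby z hz) fun z hz _ => see1 x hx hbx z hz
  have see2 : ∀ x : Point ι, x.lev = l + 3 → ∀ z : Point ι, z.lev = l + 2 →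
      ∃ z' < x, Bisimilar v z z' := by
    intro x hx z hz
    by_cases hb : Bad z
    · refine ⟨z, lt_of_offDiag (by omega) fun hd => hjj ?_, Bisimilar.refl z⟩
      exact (hb.1.elim id fun h => h.trans hd.symm).trans
        (hb.2.elim Eq.symm fun h => hd.trans h.symm)
    -- The third index `a` yields an off-diagonal point that is not bad.
    · refine ⟨pair (l + 1) j a, lt_of_offDiag (by rw [hx]; exact Nat.lt_succ_self _) haj.symm,
        sim2 _ _ hz rfl hb ?_⟩
      rintro ⟨-, h1 | h1⟩
      · exact hjj h1.symm
      · exact haj' h1.symm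
  have sim3 : ∀ x y : Point ι, x.lev = l + 3 → y.lev = l + 3 → Bisimilar v x y := fun x y hx hy =>
    bisimilar_of_level hx hy (hc x y (by omega) (by omega) (by omega) (by omega))
      (fun z hz _ => see2 y hy z hz) fun z hz _ => see2 x hx z hz
  refine bisimilar_of_views (hc p q (by omega) (by omega) (by omega) (by omega))
    (fun z hz => ?_) fun z hz => ?_
  · have := lev_lt_of_lt hz
    by_cases h3 : z.lev = l + 3
    · exact ⟨q, le_rfl, sim3 z q h3 hq⟩
    by_cases h2 : z.lev = l + 2
    · obtain ⟨z', hz', h⟩ := see2 q hq z h2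
      exact ⟨z', hz'.le, h⟩
    · exact ⟨z, (lt_of_lev (by omega)).le, Bisimilar.refl z⟩
  · have := lev_lt_of_lt hz
    exact ⟨z, (lt_of_lev (by omega)).le, Bisimilar.refl z⟩

/-- Take n to be the first level with a point outside `U`: every point from level n + 2 on lies
above it. Only levels n and n + 1 stay undetermined. -/
theorem exists_threshold (U : LowerSet (Point ι)) :
    ∃ n, ∀ p q : Point ι, (p.lev < n ∧ q.lev < n) ∨ (n + 2 ≤ p.lev ∧ n + 2 ≤ q.lev) →
      (p ∈ U ↔ q ∈ U) := by
  classical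
  by_cases h : ∃ n, ∃ p : Point ι, p.lev = n ∧ p ∉ U
  · obtain ⟨x, hx, hxU⟩ := Nat.find_spec h
    refine ⟨Nat.find h, ?_⟩
    have hlow : ∀ p : Point ι, p.lev < Nat.find h → p ∈ U := fun p hp => by
      by_contra hpU
      exact Nat.find_min h hp ⟨p, rfl, hpU⟩
    have hhigh : ∀ p : Point ι, Nat.find h + 2 ≤ p.lev → p ∉ U := fun p hp hpU =>
      hxU (U.lower (lt_of_lev (by omega)).le hpU)
    rintro p q (⟨hp, hq⟩ | ⟨hp, hq⟩)
    · exact iff_of_true (hlow p hp) (hlow q hq)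
    · exact iff_of_false (hhigh p hp) (hhigh q hq)
  · push Not at h
    exact ⟨0, fun p q _ => iff_of_true (h _ p rfl) (h _ q rfl)⟩

/-- A point with given level and indices; on the bottom level the second index is dropped. -/
def ofIndices : ℕ → ι → ι → Point ι
  | 0, i, _ => principal 0 i
  | l + 1, i, j => pair l i j

theorem ofIndices_eq (p : Point ι) : ofIndices p.lev p.fst p.snd = p := by
  obtain ⟨_ | l, i, j, h⟩ := p
  · obtain rfl : i = j := h rfl
    rfl
  · rfl

theorem exists_representatives [Fintype ι] (hk : 1 ≤ k) (hι : 2 ^ k < Fintype.card ι) :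
    ∃ ρ : (Fin 4 ⊕ Fin k × Fin 5) × ι × ι → Point ι, ∀ x, ∃ i, Bisimilar v x (ρ i) := by
  classical
  choose n hn using fun c => exists_threshold (v c)
  -- If l + 4 is none of n c, ..., n c + 4, then levels l + 1 to l + 4 are all below n c or all at
  -- least n c + 2, so `bisimilar_of_constant` moves the point one level down. Levels under 4 have
  -- no such l.
  let lv : Fin 4 ⊕ Fin k × Fin 5 → ℕ := Sum.elim (fun a => a) fun c => n c.1 + c.2
  refine ⟨fun t => ofIndices (lv t.1) t.2.1 t.2.2, ?_⟩
  have hlev : ∀ (x : Point ι) s, lv s = x.lev →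
      ∃ i : (Fin 4 ⊕ Fin k × Fin 5) × ι × ι,
        Bisimilar v x (ofIndices (lv i.1) i.2.1 i.2.2) := by
    intro x s hs
    refine ⟨(s, x.fst, x.snd), ?_⟩
    simp only [hs, ofIndices_eq]
    exact Bisimilar.refl x
  suffices H : ∀ (m : ℕ) (x : Point ι), x.lev = m →
      ∃ i : (Fin 4 ⊕ Fin k × Fin 5) × ι × ι, Bisimilar v x (ofIndices (lv i.1) i.2.1 i.2.2) from
    fun x => H _ x rfl
  intro m
  induction m with
  | zero => exact fun x hx => hlev x (Sum.inl 0) hx.symm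
  | succ m ih =>
    intro x hx
    by_cases h4 : x.lev < 4
    · exact hlev x (Sum.inl ⟨x.lev, h4⟩) rfl
    by_cases hact : ∃ c, n c ≤ x.lev ∧ x.lev < n c + 5
    · obtain ⟨c, hc1, hc2⟩ := hact
      exact hlev x (Sum.inr (c, ⟨x.lev - n c, by omega⟩)) (Nat.add_sub_cancel' hc1)
    push Not at hact
    obtain ⟨l, rfl⟩ : ∃ l, m = l + 3 := ⟨m - 3, by omega⟩
    obtain ⟨j, j', hjj, hsim⟩ := (hasBlur (v := v) hι l).exists_bisimilar
    obtain ⟨a, ha⟩ : ∃ a, a ∉ ({j, j'} : Finset ι) := by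
      by_contra hcon
      push Not at hcon
      have h1 : Fintype.card ι ≤ ({j, j'} : Finset ι).card :=
        Finset.card_le_card fun x _ => hcon x
      have h2 := Finset.card_le_two (a := j) (b := j')
      have h3 : 2 ^ 1 ≤ 2 ^ k := Nat.pow_le_pow_right (by norm_num) hk
      omega
    rw [Finset.mem_insert, Finset.mem_singleton, not_or] at ha
    have hxq := bisimilar_of_constant hjj ha.1 ha.2 hsim (p := x) (q := pair (l + 2) j j)
      (fun p q hp hp' hq hq' c => hn c p q (by have := hact c; omega)) (by omega) rfl
    obtain ⟨i, hi⟩ := ih (pair (l + 2) j j) rfl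
    exact ⟨i, hxq.trans hi⟩

end Point

/-! ### An infinite subalgebra with k + 1 generators. -/

theorem mem_finset_inf_lowerSet {P : Type u} [PartialOrder P] {β : Type*} (s : Finset β)
    (f : β → LowerSet P) (x : P) : x ∈ s.inf f ↔ ∀ i ∈ s, x ∈ f i := by
  rw [Finset.inf_eq_iInf]
  simp

theorem mem_finset_sup_lowerSet {P : Type u} [PartialOrder P] {β : Type*} (s : Finset β)
    (f : β → LowerSet P) (x : P) : x ∈ s.sup f ↔ ∃ i ∈ s, x ∈ f i := by
  rw [Finset.sup_eq_iSup]
  simp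

namespace Point

variable {ι : Type u}

/-- All points on levels below `l`, together with the points on level `l` satisfying `S`. -/
def cut (l : ℕ) (S : ι → ι → Prop) : LowerSet (Point ι) where
  carrier := {p | p.lev < l ∨ (p.lev = l ∧ S p.fst p.snd)}
  lower' := by
    intro p q hqp hp
    rcases hqp.eq_or_lt with rfl | h
    · exact hp
    · have := lev_lt_of_lt h
      left
      rcases hp with hp | hp <;> omega

theorem mem_cut {l : ℕ} {S : ι → ι → Prop} {p : Point ι} :
    p ∈ cut l S ↔ p.lev < l ∨ (p.lev = l ∧ S p.fst p.snd) := Iff.rfl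

/-- All points on levels below `l`. -/
abbrev below (l : ℕ) : LowerSet (Point ι) := cut l fun _ _ => False

/-- Relative pseudocomplement, truncated above level l, acts as Boolean complement within level l.
-/
theorem cut_not (l : ℕ) (S : ι → ι → Prop) :
    (cut l S ⇨ below l) ⊓ below (l + 1) = cut l fun i j => ¬ S i j := by
  refine SetLike.ext fun p => ?_
  simp only [LowerSet.mem_inf_iff, mem_himp_lowerSet, mem_cut, and_false, or_false]
  constructor
  · rintro ⟨h1, h2⟩
    by_cases h : p.lev < l
    · exact Or.inl h
    · refine Or.inr ⟨by omega, fun hS => h ?_⟩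
      exact h1 p le_rfl (Or.inr ⟨by omega, hS⟩)
  · rintro (h | h)
    · refine ⟨fun q hq _ => ?_, by omega⟩
      rcases hq.eq_or_lt with rfl | hq
      · exact h
      · have := lev_lt_of_lt hq
        omega
    · refine ⟨fun q hq hqS => ?_, by omega⟩
      rcases hq.eq_or_lt with rfl | hq
      · exact hqS.elim id fun h' => absurd h'.2 h.2
      · have := lev_lt_of_lt hq
        omega

/-- Above level l, the points that do not see the principal point a are exactly those of level l + 1
carrying the index a. -/
theorem cut_succ_miss (l : ℕ) (a : ι) :
    (cut l (fun i j => i = a ∧ j = a) ⇨ below l) ⊔ below (l + 1) =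
      cut (l + 1) fun i j => a = i ∨ a = j := by
  refine SetLike.ext fun p => ?_
  simp only [LowerSet.mem_sup_iff, mem_himp_lowerSet, mem_cut, and_false, or_false]
  constructor
  · rintro (h | h)
    · by_contra hcon
      push Not at hcon
      have hlt : principal l a < p := by
        rw [lt_iff]
        change l + 2 ≤ _ ∨ (l + 1 = _ ∧ ¬ (a = a ∧ (a = p.fst ∨ a = p.snd)))
        by_cases h2 : l + 2 ≤ p.lev
        · exact Or.inl h2
        · refine Or.inr ⟨by omega, fun h3 => ?_⟩
          have := hcon.2 (by omega)
          exact h3.2.elim this.1 this.2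
      exact lt_irrefl l (h _ hlt.le (Or.inr ⟨rfl, rfl, rfl⟩))
    · exact Or.inl h
  · rintro (h | ⟨h, ha⟩)
    · exact Or.inr h
    · left
      rintro q hq (hql | ⟨hql, rfl, hqs⟩)
      · exact hql
      · exfalso
        rcases hq.eq_or_lt with rfl | hq
        · omega
        · have := fst_ne_of_lt hq (by omega) hqs.symm
          exact ha.elim this.1 this.2

variable [Fintype ι]

/-- Each index defines the set of points one level up that carry it. These sets cover that level,
and a diagonal point is the one carrying its index and no other. -/
theorem cut_mem_succ [DecidableEq ι] (C : lang.Substructure (LowerSet (Point ι))) {l : ℕ}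
    (h0 : below l ∈ C) (h1 : below (l + 1) ∈ C)
    (hp : ∀ a, cut l (fun i j => i = a ∧ j = a) ∈ C) :
    below (l + 2) ∈ C ∧ ∀ a, cut (l + 1) (fun i j => i = a ∧ j = a) ∈ C := by
  have hm : ∀ a, cut (l + 1) (fun i j => a = i ∨ a = j) ∈ C := fun a => by
    rw [← cut_succ_miss]
    exact sup_mem_substructure C (himp_mem_substructure C (hp a) h0) h1
  have h2 : below (l + 2) ∈ C := by
    have : (below (l + 2) : LowerSet (Point ι)) =
        below (l + 1) ⊔ Finset.univ.sup fun a => cut (l + 1) fun i j => a = i ∨ a = j := by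
      refine SetLike.ext fun p => ?_
      simp only [LowerSet.mem_sup_iff, mem_finset_sup_lowerSet, mem_cut, and_false, or_false, Finset.mem_univ, true_and]
      constructor
      · intro h
        by_cases h' : p.lev < l + 1
        · exact Or.inl h'
        · exact Or.inr ⟨p.fst, Or.inr ⟨by omega, Or.inl rfl⟩⟩
      · rintro (h | ⟨a, h | h⟩) <;> omega
    rw [this]
    exact sup_mem_substructure C h1 (finset_sup_mem_substructure C _ fun a _ => hm a)
  refine ⟨h2, fun a => ?_⟩
  have : cut (l + 1) (fun i j => i = a ∧ j = a) =
      cut (l + 1) (fun i j => a = i ∨ a = j) ⊓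
        (Finset.univ.erase a).inf fun b => cut (l + 1) fun i j => ¬ (b = i ∨ b = j) := by
    refine SetLike.ext fun p => ?_
    simp only [LowerSet.mem_inf_iff, mem_finset_inf_lowerSet, mem_cut, Finset.mem_erase, Finset.mem_univ, and_true]
    constructor
    · rintro (h | ⟨h, h1, h2⟩)
      · exact ⟨Or.inl h, fun _ _ => Or.inl h⟩
      · refine ⟨Or.inr ⟨h, Or.inl h1.symm⟩, fun b hb => Or.inr ⟨h, ?_⟩⟩
        rintro (h3 | h3)
        · exact hb (h3.trans h1)
        · exact hb (h3.trans h2)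
    · rintro ⟨h | ⟨h, -⟩, hb⟩
      · exact Or.inl h
      · refine Or.inr ⟨h, ?_, ?_⟩
        · by_contra hne
          rcases hb _ hne with h' | h'
          · omega
          · exact h'.2 (Or.inl rfl)
        · by_contra hne
          rcases hb _ hne with h' | h'
          · omega
          · exact h'.2 (Or.inr rfl)
  rw [this]
  refine inf_mem_substructure C (hm a) (finset_inf_mem_substructure C _ fun b _ => ?_)
  rw [← cut_not]
  exact inf_mem_substructure C (himp_mem_substructure C (hm b) h1) h2

/-- Injective colours isolate the bottom points, nonempty ones make the generators cover the bottom
level; `cut_mem_succ` then climbs through all levels. -/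
theorem infinite_closure [Nonempty ι] {κ : Type*} [Fintype κ] (col : ι → Finset κ)
    (hinj : Function.Injective col) (hne : ∀ i, (col i).Nonempty) :
    (Language.Substructure.closure lang
      (Set.range fun c : κ => cut 0 fun i _ => c ∈ col i) : Set (LowerSet (Point ι))).Infinite := by
  classical
  set C := Language.Substructure.closure lang
    (Set.range fun c : κ => (cut 0 fun i _ => c ∈ col i : LowerSet (Point ι)))
  have hgen : ∀ c, cut 0 (fun i _ => c ∈ col i) ∈ C := fun c =>
    Language.Substructure.subset_closure ⟨c, rfl⟩
  have h0 : below 0 ∈ C := by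
    have : (below 0 : LowerSet (Point ι)) = ⊥ := by
      refine SetLike.ext fun p => ?_
      change _ ↔ False
      simp [mem_cut]
    rw [this]
    exact bot_mem_substructure C
  have h1 : below 1 ∈ C := by
    have : (below 1 : LowerSet (Point ι)) =
        Finset.univ.sup fun c => cut 0 fun i _ => c ∈ col i := by
      refine SetLike.ext fun p => ?_
      simp only [mem_finset_sup_lowerSet, mem_cut, and_false, or_false, Finset.mem_univ, true_and,
        Nat.not_lt_zero, false_or, Nat.lt_one_iff]
      constructor
      · intro h
        obtain ⟨c, hc⟩ := hne p.fst
        exact ⟨c, h, hc⟩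
      · rintro ⟨c, h, -⟩
        exact h
    rw [this]
    exact finset_sup_mem_substructure C _ fun c _ => hgen c
  have hp : ∀ a, cut 0 (fun i j => i = a ∧ j = a) ∈ C := by
    intro a
    have : cut 0 (fun i j => i = a ∧ j = a) = below 1 ⊓
        Finset.univ.inf fun c => cut 0 fun i (_ : ι) => (c ∈ col i ↔ c ∈ col a) := by
      refine SetLike.ext fun p => ?_
      simp only [LowerSet.mem_inf_iff, mem_finset_inf_lowerSet, mem_cut, and_false, or_false, Finset.mem_univ,
        forall_true_left, Nat.not_lt_zero, false_or, Nat.lt_one_iff]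
      constructor
      · rintro ⟨h, rfl, -⟩
        exact ⟨h, fun c => ⟨h, Iff.rfl⟩⟩
      · rintro ⟨h, hc⟩
        have : p.fst = a := hinj (Finset.ext fun c => (hc c).2)
        exact ⟨h, this, (p.diag h) ▸ this⟩
    rw [this]
    refine inf_mem_substructure C h1 (finset_inf_mem_substructure C _ fun c _ => ?_)
    by_cases hc : c ∈ col a
    · simpa only [hc, iff_true] using hgen c
    · simp only [hc, iff_false]
      rw [← cut_not]
      exact inf_mem_substructure C (himp_mem_substructure C (hgen c) h0) h1
  have hmem : ∀ n, below n ∈ C ∧ below (n + 1) ∈ C ∧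
      ∀ a, cut n (fun i j => i = a ∧ j = a) ∈ C := by
    intro n
    induction n with
    | zero => exact ⟨h0, h1, hp⟩
    | succ n ih => exact ⟨ih.2.1, cut_mem_succ C ih.1 ih.2.1 ih.2.2⟩
  refine Set.infinite_of_injective_forall_mem (f := (below : ℕ → LowerSet (Point ι)))
    (fun a b h => ?_) fun n => (hmem n).1
  have hiff : ∀ n, n < a ↔ n < b := fun n => by
    have := SetLike.ext_iff.1 h (principal n (Classical.arbitrary ι))
    simpa [mem_cut, principal] using this
  have ha := hiff a
  have hb := hiff b
  omega

/-- There are 2^(k+1) - 1 nonempty colours, which is at least 2^k + 1 exactly when k ≥ 1. -/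
theorem exists_coloring {k : ℕ} (hk : 1 ≤ k) :
    ∃ col : ULift.{u} (Fin (2 ^ k + 1)) → Finset (Fin (k + 1)),
      Function.Injective col ∧ ∀ i, (col i).Nonempty := by
  classical
  have hcard : Fintype.card (ULift.{u} (Fin (2 ^ k + 1))) ≤
      Fintype.card {s : Finset (Fin (k + 1)) // s ≠ ∅} := by
    rw [Fintype.card_subtype_compl, Fintype.card_finset, Fintype.card_ulift, Fintype.card_fin,
      Fintype.card_fin, Fintype.card_subtype_eq, pow_succ]
    have : 2 ^ 1 ≤ 2 ^ k := Nat.pow_le_pow_right (by norm_num) hk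
    omega
  obtain ⟨f⟩ := Function.Embedding.nonempty_of_card_le hcard
  exact ⟨fun i => (f i).1, fun i j h => f.injective (Subtype.ext h),
    fun i => Finset.nonempty_iff_ne_empty.2 (f i).2⟩

end Point

end HeytingVariety

theorem mainTheorem3 (k : ℕ) :
    ∃ V : Set HeytAlg.{u},
      HeytingVariety.IsVariety V ∧
      HeytingVariety.IsFinitelyAxiomatisable V ∧
      HeytingVariety.IsRegularlyKFinite k V ∧
      ∃ A ∈ V, Infinite A ∧ HeytingVariety.IsGenerated (k + 1) A := by
  open HeytingVariety in
  rcases Nat.eq_zero_or_pos k with rfl | hk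
  · obtain ⟨E, hE, hA, hfin⟩ := exists_finite_axioms (k := 0) (A := LowerSet Ladder.{u})
      fun v => ⟨_, injOn_closure_empty v⟩
    exact ⟨models E, ⟨E, rfl⟩, ⟨E, hE, rfl⟩, hfin,
      exists_infinite_generated hA _ Ladder.infinite_closure⟩
  · let ι := ULift.{u} (Fin (2 ^ k + 1))
    obtain ⟨E, hE, hA, hfin⟩ := exists_finite_axioms (k := k) (A := LowerSet (Point ι))
      (Γ := (Fin 4 ⊕ Fin k × Fin 5) × ι × ι → Prop) fun v => by
        obtain ⟨ρ, hρ⟩ := Point.exists_representatives (v := v) hk (by simp [ι])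
        exact ⟨_, injOn_closure_of_representatives ρ hρ⟩
    obtain ⟨col, hinj, hne⟩ := Point.exists_coloring.{u} hk
    exact ⟨models E, ⟨E, rfl⟩, ⟨E, hE, rfl⟩, hfin,
      exists_infinite_generated hA _ (Point.infinite_closure col hinj hne)⟩
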